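/- Let $T=(V,E)$ be a locally finite tree with a finite or countable vertex set, with a root vertex $o$ and a pre-root $o^*$ (a vertex adjacent to $o$ and to no other vertex). Let $\overline T$ be the set of vertices together with the infinite geodesics emanating from $o^*$ (finite maximal geodesics are identified with the leaves at which they end). For $x\in\overline T$ let $[o^*,x]$ be the set of edges of the geodesic from $o^*$ to $x$. For edges $\alpha,\beta$, let $e(\alpha)$ be the endpoint of $\alpha$ furthest from $o^*$, let $S(\alpha)=\{x\in\overline T:\alpha\in[o^*,x]\}$, and write $\beta\subseteq\alpha$ if $\alpha\in[o^*,e(\beta)]$. Give $\overline T$ the topology generated by the sets $S(\alpha)$ and the singletons of vertices. For $x,y\in\overline T$ let $d(x\wedge y)\in\{0,1,\dots,\infty\}$ be the number of edges in $[o^*,x\wedge y]=[o^*,x]\cap[o^*,y]$. For $\varphi:E\to[0,\infty)$ put $\mathcal I\varphi(x)=\sum_{\alpha\in[o^*,x]}\varphi(\alpha)$. Let $\mu\ge 0$ be a Borel measure on $\overline T$ with $\mu(S(\alpha))<\infty$ for all $\alpha\in E$, and set, for real $s\ge1$, $$[[\mu]]=\sup_{\alpha\in E}\frac1{\mu(S(\alpha))}\sum_{\beta\subseteq\alpha}\mu(S(\beta))^2,\qquad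 [[\mu]]_s=\sup_{\alpha\in E}\frac1{\mu(S(\alpha))}\int_{S(\alpha)}\Big(\int_{S(\alpha)}d(x\wedge y)\,d\mu(x)\Big)^s d\mu(y),$$ both in $[0,\infty]$, where edges with $\mu(S(\alpha))=0$ contribute $0$. (1) (Reverse Hölder inequality.) For every $s>1$ there is a finite constant $C_s$, depending only on $s$ (not on $T$ or $\mu$), such that $[[\mu]]_s\le C_s\,[[\mu]]^s$ for all such $T$ and $\mu$. (2) For all such $T$ and $\mu$, the following are equivalent: (a) the Hardy inequality holds, i.e. there is a finite constant $C$ with $\int_{\overline T}(\mathcal I\varphi)^2\,d\mu\le C\sum_{\alpha\in E}\varphi(\alpha)^2$ for all $\varphi:E\to[0,\infty)$; (b) $[[\mu]]_s<\infty$ for some $s\ge1$; (c) $[[\mu]]_s<\infty$ for every $s\ge1$. -/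

import Mathlib

open MeasureTheory
open scoped ENNReal NNReal

universe u

/-- A locally finite tree on the vertex set `V`, with a distinguished root `o` and a pre-root `o*`,
a vertex which is adjacent to `o` and to no other vertex. -/
structure HardyTree (V : Type u) where
  graph : SimpleGraph V
  isTree : graph.IsTree
  locallyFinite : ∀ v, (graph.neighborSet v).Finite
  /-- the pre-root `o*` -/
  preRoot : V
  /-- the root `o` -/
  root : V
  neighborSet_preRoot : graph.neighborSet preRoot = {root}

namespace HardyTree

variable {V : Type u} (T : HardyTree V)

/-- The set `E` of edges. -/
abbrev Edge : Type u := T.graph.edgeSet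

/-- Infinite geodesics `r 0 = o*, r 1 = o, r 2, …` emanating from `o*`. -/
structure Ray where
  toFun : ℕ → V
  zero' : toFun 0 = T.preRoot
  geodesic' : ∀ m k, T.graph.dist (toFun m) (toFun (m + k)) = k

/-- The set `T ∪ ∂T`: the vertices, together with the infinite geodesics emanating from `o*`.
A finite maximal geodesic emanating from `o*` is identified with the leaf at which it ends. -/
inductive Closure where
  | vertex (x : V) : Closure
  | ray (r : T.Ray) : Closure

/-- `[o*, x]` as a set of edges, for `x` a vertex: the edges of the (unique) path from `o*`
to `x`. -/
def vertexGeodesic (x : V) : Set T.Edge :=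
  {α | ∃ p : T.graph.Walk T.preRoot x, p.IsPath ∧ (α : Sym2 V) ∈ p.edges}

/-- `[o*, x]` as a set of edges, for `x` a vertex or a boundary point. -/
def geodesic : T.Closure → Set T.Edge
  | .vertex x => T.vertexGeodesic x
  | .ray r => {α | ∃ n, (α : Sym2 V) = s(r.toFun n, r.toFun (n + 1))}

theorem exists_furthest (α : T.Edge) : ∃ v ∈ (α : Sym2 V), ∀ w ∈ (α : Sym2 V),
    T.graph.dist T.preRoot w ≤ T.graph.dist T.preRoot v := by
  obtain ⟨α, hα⟩ := α
  induction α using Sym2.ind with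
  | _ a b =>
    rcases le_total (T.graph.dist T.preRoot a) (T.graph.dist T.preRoot b) with h | h
    · refine ⟨b, by simp, ?_⟩
      simp [h]
    · refine ⟨a, by simp, ?_⟩
      simp [h]

/-- `e(α)`: the endpoint of `α` which is furthest from `o*`. -/
noncomputable def endVertex (α : T.Edge) : V := (T.exists_furthest α).choose

/-- The order `α ⊆ β` on edges: `β` lies on the geodesic `[o*, e(α)]`. -/
def Below (α β : T.Edge) : Prop := β ∈ T.vertexGeodesic (T.endVertex α)

/-- The successor set `S(α)`. -/
def succSet (α : T.Edge) : Set T.Closure := {x | α ∈ T.geodesic x}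

/-- The topology generated by the successor sets and the singletons of vertices. -/
instance : TopologicalSpace T.Closure :=
  TopologicalSpace.generateFrom
    (Set.range T.succSet ∪ Set.range fun x : V => {Closure.vertex x})

instance : MeasurableSpace T.Closure := borel T.Closure

instance : BorelSpace T.Closure := ⟨rfl⟩

/-- `d(x ∧ y)`, the number of edges in `[o*, x ∧ y]`. The confluent `x ∧ y` is the point
determined by `[o*, x ∧ y] = [o*, x] ∩ [o*, y]`; if `x = y` is an infinite geodesic, then
`d(x ∧ y) = ∞`. -/
noncomputable def confluentDist (x y : T.Closure) : ℝ≥0∞ :=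
  ((T.geodesic x ∩ T.geodesic y).encard : ℕ∞)

/-- The Hardy operator `𝓘 φ(x) = ∑_{α ∈ [o*, x]} φ(α)`, with values in `[0, ∞]`. -/
noncomputable def hardyOp (φ : T.Edge → ℝ≥0) (x : T.Closure) : ℝ≥0∞ :=
  ∑' α : T.geodesic x, (φ α : ℝ≥0∞)

/-- The Hardy inequality (for `p = 2` and `π ≡ 1`) holds with some finite constant. -/
def HardyInequality (μ : Measure T.Closure) : Prop :=
  ∃ C : ℝ≥0, ∀ φ : T.Edge → ℝ≥0,
    ∫⁻ x, T.hardyOp φ x ^ 2 ∂μ ≤ C * ∑' α : T.Edge, (φ α : ℝ≥0∞) ^ 2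

/-- The mass-energy constant `[[μ]]` (for `p = 2` and `π ≡ 1`),
`sup_α μ(S(α))⁻¹ ∑_{β ⊆ α} μ(S(β))²`; edges with `μ(S(α)) = 0` contribute `0`. -/
noncomputable def massEnergy (μ : Measure T.Closure) : ℝ≥0∞ :=
  ⨆ α : T.Edge, (μ (T.succSet α))⁻¹ * ∑' β : {β : T.Edge // T.Below β α}, μ (T.succSet β) ^ 2

/-- The `s`-testing constant `[[μ]]_s`, the supremum over `α` of the average over `y ∈ S(α)` of
`(∫_{S(α)} d(x ∧ y) dμ(x)) ^ s`; edges with `μ(S(α)) = 0` contribute `0`. -/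
noncomputable def testing (μ : Measure T.Closure) (s : ℝ) : ℝ≥0∞ :=
  ⨆ α : T.Edge,
    ⨍⁻ y in T.succSet α, (∫⁻ x in T.succSet α, T.confluentDist x y ∂μ) ^ s ∂μ

end HardyTree

/-! Write `If` for the sum of `f` along a geodesic and `M` for `[[μ]]`. Everything rests on the
discrete chain rule `(If)^(n+1) ≤ (n+1) I(f (If)^n)`. Integrated against `μ`, it bounds `∫
(If)^(n+1)` by `(n+1) ∑ f (If)^n μ(S)`. Summed against the weights `μ(S)²`, with the order of
summation exchanged and the definition of `M` applied, it gives `∑ μ(S)² (If)^(n+1) ≤ (n+1) M ∑ f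
(If)^n μ(S)`.

For `n = 1` these two bounds and Cauchy–Schwarz give Hardy's inequality with constant `4M`; the
converse is duality. For `f = μ(S(β))` on the edges `β ⊆ α`, where `f μ(S) ≤ μ(S)²`, iterating the
second bound gives `∫ (If)^n ≤ n! M^n μ(S(α))` for `n ≥ 1`.

On `S(α)` the inner integral of `[[μ]]_s` is at most `4M + If`: edges below `α` give `If`, and those
above are controlled by Hardy's inequality. The moment bounds then yield the reverse Hölder
inequality (`testing_le`). Conversely `M ≤ 1 + [[μ]]_s`, since the double integral of `d(x ∧ y)`
over `S(α)` dominates `∑ μ(S(β))²`. -/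

/-! ### Chain rule for finite sums, and Cauchy–Schwarz -/

theorem ENNReal.add_pow_succ_le (b a : ℝ≥0∞) (n : ℕ) :
    (b + a) ^ (n + 1) ≤ b ^ (n + 1) + (n + 1) * (a * (b + a) ^ n) := by
  induction n with
  | zero => simp
  | succ n ih =>
    calc (b + a) ^ (n + 1 + 1) = (b + a) ^ (n + 1) * b + a * (b + a) ^ (n + 1) := by ring
      _ ≤ (b ^ (n + 1) + (n + 1) * (a * (b + a) ^ n)) * b + a * (b + a) ^ (n + 1) := by gcongr
      _ = b ^ (n + 1 + 1) + ((n + 1) * (a * ((b + a) ^ n * b)) + a * (b + a) ^ (n + 1)) := by ring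
      _ ≤ b ^ (n + 1 + 1) +
          ((n + 1) * (a * ((b + a) ^ n * (b + a))) + a * (b + a) ^ (n + 1)) := by
        gcongr; exact le_self_add
      _ = b ^ (n + 1 + 1) + (((n + 1 : ℕ) : ℝ≥0∞) + 1) * (a * (b + a) ^ (n + 1)) := by
        push_cast; ring

/-- A discrete form of `d(u^(n+1)) = (n+1) u^n du`. Remove an index of maximal rank: its partial sum
is the whole sum. Ties in rank only enlarge the right side. -/
theorem ENNReal.sum_pow_succ_le {ι : Type*} (r : ι → ℕ) (a : ι → ℝ≥0∞) (n : ℕ) (F : Finset ι) :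
    (∑ i ∈ F, a i) ^ (n + 1) ≤
      (n + 1) * ∑ i ∈ F, a i * (∑ j ∈ F with r j ≤ r i, a j) ^ n := by
  classical
  induction F using Finset.induction_on_max_value r with
  | empty => simp
  | insert m F hm hmax ih =>
    rw [Finset.sum_insert hm, Finset.sum_insert hm, mul_add, add_comm (a m)]
    have h1 : Finset.filter (fun j => r j ≤ r m) (insert m F) = insert m F := by
      apply Finset.filter_true_of_mem
      intro j hj
      rcases Finset.mem_insert.1 hj with rfl | h
      · exact le_rfl
      · exact hmax j h
    rw [h1, Finset.sum_insert hm, add_comm (a m)]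
    refine (ENNReal.add_pow_succ_le _ _ n).trans ?_
    rw [add_comm]
    gcongr
    refine ih.trans ?_
    gcongr
    exact Finset.subset_insert _ _

theorem ENNReal.sq_lintegral_mul_le {α : Type*} [MeasurableSpace α] (μ : Measure α)
    {f g : α → ℝ≥0∞} (hf : AEMeasurable f μ) (hg : AEMeasurable g μ) :
    (∫⁻ x, f x * g x ∂μ) ^ 2 ≤ (∫⁻ x, f x ^ 2 ∂μ) * ∫⁻ x, g x ^ 2 ∂μ := by
  have h := ENNReal.lintegral_mul_le_Lp_mul_Lq μ Real.HolderConjugate.two_two hf hg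
  have key : ∀ z : ℝ≥0∞, (z ^ (1 / 2 : ℝ)) ^ 2 = z := fun z => by
    rw [← ENNReal.rpow_natCast, ← ENNReal.rpow_mul]; norm_num
  calc _ ≤ _ := pow_le_pow_left' h 2
    _ = _ := by
      rw [mul_pow, key, key]
      norm_cast

theorem ENNReal.sq_tsum_mul_le {ι : Type*} (f g : ι → ℝ≥0∞) :
    (∑' i, f i * g i) ^ 2 ≤ (∑' i, f i ^ 2) * ∑' i, g i ^ 2 := by
  let _ : MeasurableSpace ι := ⊤
  have h := ENNReal.sq_lintegral_mul_le (Measure.count : Measure ι) (f := f) (g := g)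
    measurable_from_top.aemeasurable measurable_from_top.aemeasurable
  simpa only [lintegral_count] using h

/-! ### Geodesics and the order on edges -/

namespace HardyTree

variable {V : Type u} (T : HardyTree V)

theorem length_eq_dist {x : V} (q : T.graph.Walk T.preRoot x) (hq : q.IsPath) :
    q.length = T.graph.dist T.preRoot x := by
  obtain ⟨w, hw, hl⟩ := (T.isTree.connected T.preRoot x).exists_path_of_dist
  have := (T.isTree.isAcyclic.subsingleton_path _ _).elim ⟨q, hq⟩ ⟨w, hw⟩
  rw [← hl, Subtype.mk.inj this]

/-- A geodesic sequence of length `N ≤ ∞` which starts at `o*`. -/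
structure IsGeodesicSeq (p : ℕ → V) (N : ℕ∞) : Prop where
  zero : p 0 = T.preRoot
  adj : ∀ n : ℕ, n < N → T.graph.Adj (p n) (p (n + 1))
  dist : ∀ n : ℕ, n ≤ N → T.graph.dist T.preRoot (p n) = n

variable {T}

theorem IsGeodesicSeq.mem_vertexGeodesic {p : ℕ → V} {N : ℕ∞} (h : T.IsGeodesicSeq p N)
    {k : ℕ} (hk : k ≤ N) (α : T.Edge) :
    α ∈ T.vertexGeodesic (p k) ↔ ∃ n < k, (α : Sym2 V) = s(p n, p (n + 1)) := by
  have H : ∀ k : ℕ, k ≤ N → ∃ w : T.graph.Walk T.preRoot (p k), w.length = k ∧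
      ∀ e, e ∈ w.edges ↔ ∃ n < k, e = s(p n, p (n + 1)) := by
    intro k
    induction k with
    | zero =>
      intro _
      refine ⟨SimpleGraph.Walk.nil.copy rfl h.zero.symm, by simp, by simp⟩
    | succ k ih =>
      intro hk
      obtain ⟨w, hl, hw⟩ := ih (le_trans (by simp) hk)
      refine ⟨w.concat (h.adj k ((ENat.add_one_le_iff (by simp)).1 (by exact_mod_cast hk))),
        by simp [hl], fun e => ?_⟩
      simp only [SimpleGraph.Walk.edges_concat, List.concat_eq_append, List.mem_append, hw,
        List.mem_singleton, Nat.lt_succ_iff_lt_or_eq]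
      constructor
      · rintro (⟨n, hn, rfl⟩ | rfl)
        · exact ⟨n, .inl hn, rfl⟩
        · exact ⟨k, .inr rfl, rfl⟩
      · rintro ⟨n, hn | rfl, rfl⟩
        · exact .inl ⟨n, hn, rfl⟩
        · exact .inr rfl
  obtain ⟨w, hl, hw⟩ := H k hk
  have hwp : w.IsPath := w.isPath_of_length_eq_dist (by rw [hl, h.dist k hk])
  rw [← hw]
  constructor
  · rintro ⟨q, hq, hα⟩
    rwa [Subtype.mk.inj ((T.isTree.isAcyclic.subsingleton_path _ _).elim ⟨q, hq⟩ ⟨w, hwp⟩)] at hα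
  · exact fun hα => ⟨w, hwp, hα⟩

theorem IsGeodesicSeq.endVertex {p : ℕ → V} {N : ℕ∞} (h : T.IsGeodesicSeq p N)
    {n : ℕ} (hn : n < N) {α : T.Edge} (hα : (α : Sym2 V) = s(p n, p (n + 1))) :
    T.endVertex α = p (n + 1) := by
  have hmem := (T.exists_furthest α).choose_spec.1
  have hfar := (T.exists_furthest α).choose_spec.2 (p (n + 1)) (by rw [hα]; simp)
  change T.endVertex α ∈ _ at hmem
  change _ ≤ T.graph.dist T.preRoot (T.endVertex α) at hfar
  rw [hα, Sym2.mem_iff] at hmem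
  rcases hmem with h' | h'
  · rw [h', h.dist n hn.le,
      h.dist (n + 1) (by exact_mod_cast (ENat.add_one_le_iff (by simp)).2 hn)] at hfar
    omega
  · exact h'

variable (T)

/-- Lets vertices and boundary points be treated alike; `N` is the path length, or `⊤` for a ray. -/
theorem exists_isGeodesicSeq (x : T.Closure) : ∃ (p : ℕ → V) (N : ℕ∞), T.IsGeodesicSeq p N ∧
    ∀ α, α ∈ T.geodesic x ↔ ∃ n : ℕ, n < N ∧ (α : Sym2 V) = s(p n, p (n + 1)) := by
  cases x with
  | vertex x =>
    obtain ⟨q, hq, -⟩ := (T.isTree.connected T.preRoot x).exists_path_of_dist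
    have h : T.IsGeodesicSeq q.getVert q.length := by
      refine ⟨by simp, fun n hn => q.adj_getVert_succ (by exact_mod_cast hn), fun n hn => ?_⟩
      have hn' : n ≤ q.length := by exact_mod_cast hn
      rw [← T.length_eq_dist (q.take n) (hq.take n)]
      simp [SimpleGraph.Walk.take_length, hn']
    refine ⟨_, _, h, fun α => ?_⟩
    have := h.mem_vertexGeodesic le_rfl α
    rw [q.getVert_length] at this
    simpa [geodesic] using this
  | ray r =>
    refine ⟨r.toFun, ⊤, ⟨r.zero', fun n _ => ?_, fun n _ => ?_⟩, fun α => by simp [geodesic]⟩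
    · rw [← SimpleGraph.dist_eq_one_iff_adj]; exact r.geodesic' n 1
    · have := r.geodesic' 0 n
      rwa [r.zero', zero_add] at this

/-- The number of edges of `[o*, e(α)]`. -/
noncomputable def depth (α : T.Edge) : ℕ := T.graph.dist T.preRoot (T.endVertex α)

variable {T}

theorem Below.mem_geodesic {α β : T.Edge} (h : T.Below α β) {x : T.Closure}
    (hx : α ∈ T.geodesic x) : β ∈ T.geodesic x := by
  obtain ⟨p, N, hp, hG⟩ := T.exists_isGeodesicSeq x
  obtain ⟨n, hn, hα⟩ := (hG α).1 hx
  rw [Below, hp.endVertex hn hα, hp.mem_vertexGeodesic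
    (by exact_mod_cast (ENat.add_one_le_iff (by simp)).2 hn)] at h
  obtain ⟨m, hm, hβ⟩ := h
  exact (hG β).2 ⟨m, lt_of_le_of_lt (by exact_mod_cast Nat.lt_succ_iff.1 hm) hn, hβ⟩

/-- The edges of one geodesic form a chain ordered by depth, so `depth` can serve as the rank in
`ENNReal.sum_pow_succ_le`. -/
theorem below_of_depth_le {α β : T.Edge} {x : T.Closure} (hα : α ∈ T.geodesic x)
    (hβ : β ∈ T.geodesic x) (h : T.depth β ≤ T.depth α) : T.Below α β := by
  obtain ⟨p, N, hp, hG⟩ := T.exists_isGeodesicSeq x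
  obtain ⟨n, hn, hα⟩ := (hG α).1 hα
  obtain ⟨m, hm, hβ⟩ := (hG β).1 hβ
  have hn' : ((n + 1 : ℕ) : ℕ∞) ≤ N := by exact_mod_cast (ENat.add_one_le_iff (by simp)).2 hn
  have hm' : ((m + 1 : ℕ) : ℕ∞) ≤ N := by exact_mod_cast (ENat.add_one_le_iff (by simp)).2 hm
  rw [depth, depth, hp.endVertex hn hα, hp.endVertex hm hβ, hp.dist _ hn', hp.dist _ hm'] at h
  rw [Below, hp.endVertex hn hα, hp.mem_vertexGeodesic hn']
  exact ⟨m, by omega, hβ⟩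

variable (T)

theorem below_refl (α : T.Edge) : T.Below α α := by
  obtain ⟨x, hx⟩ : ∃ x, α ∈ T.geodesic (.vertex x) := by
    obtain ⟨e, he⟩ := α
    induction e using Sym2.ind with
    | _ a b =>
      have hab : T.graph.Adj a b := he
      obtain ⟨q, hq, -⟩ := (T.isTree.connected T.preRoot a).exists_path_of_dist
      obtain ⟨q', hq', -⟩ := (T.isTree.connected T.preRoot b).exists_path_of_dist
      -- If the path to `a` passes through `b`, the edge is its last one; otherwise the edge
      -- prolongs that path to `b`.
      by_cases hb : b ∈ q.support
      · refine ⟨a, q, hq, ?_⟩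
        rw [T.isTree.isAcyclic.path_concat hq' hq hab.symm hb, SimpleGraph.Walk.edges_concat]
        simp [Sym2.eq_swap]
      · exact ⟨b, q.concat hab, hq.concat hb hab, by simp [SimpleGraph.Walk.edges_concat]⟩
  exact below_of_depth_le hx hx le_rfl

theorem vertexGeodesic_finite (x : V) : (T.vertexGeodesic x).Finite := by
  obtain ⟨q, hq, -⟩ := (T.isTree.connected T.preRoot x).exists_path_of_dist
  refine Set.Finite.of_injOn (f := Subtype.val) (t := {e | e ∈ q.edges}) ?_
    Subtype.val_injective.injOn (List.finite_toSet _)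
  rintro α ⟨w, hw, hα⟩
  rwa [Subtype.mk.inj ((T.isTree.isAcyclic.subsingleton_path _ _).elim ⟨w, hw⟩ ⟨q, hq⟩)] at hα

theorem measurableSet_succSet (α : T.Edge) : MeasurableSet (T.succSet α) :=
  (TopologicalSpace.isOpen_generateFrom_of_mem (.inl ⟨α, rfl⟩)).measurableSet

end HardyTree

/-! ### The chain rule on the tree and Hardy's inequality -/

namespace HardyTree

variable {V : Type u} (T : HardyTree V)

/-- The sum of `f` over `[o*, x]`, for `f` with values in `[0, ∞]`. -/
noncomputable def treeSum (f : T.Edge → ℝ≥0∞) (x : T.Closure) : ℝ≥0∞ :=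
  ∑' α, (T.geodesic x).indicator f α

/-- The sum of `f` over `[o*, e(α)]`. -/
noncomputable def ancSum (f : T.Edge → ℝ≥0∞) (α : T.Edge) : ℝ≥0∞ :=
  T.treeSum f (.vertex (T.endVertex α))

theorem hardyOp_eq_treeSum (φ : T.Edge → ℝ≥0) (x : T.Closure) :
    T.hardyOp φ x = T.treeSum (fun α => φ α) x :=
  tsum_subtype (T.geodesic x) fun α => (φ α : ℝ≥0∞)

variable {T}

theorem ancSum_eq (f : T.Edge → ℝ≥0∞) (α : T.Edge) :
    T.ancSum f α = ∑' β, {β | T.Below α β}.indicator f β := rfl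

theorem treeSum_pow_succ_le (f : T.Edge → ℝ≥0∞) (x : T.Closure) (n : ℕ) :
    T.treeSum f x ^ (n + 1) ≤ (n + 1) * T.treeSum (fun α => f α * T.ancSum f α ^ n) x := by
  classical
  set g := (T.geodesic x).indicator f with hg
  have hfin : ∀ F : Finset T.Edge, (∑ α ∈ F, g α) ^ (n + 1) ≤
      (n + 1) * T.treeSum (fun α => f α * T.ancSum f α ^ n) x := by
    intro F
    refine (ENNReal.sum_pow_succ_le T.depth g n F).trans ?_
    gcongr
    refine le_trans (Finset.sum_le_sum fun α _ => ?_) (ENNReal.sum_le_tsum F)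
    by_cases hα : α ∈ T.geodesic x
    · rw [Set.indicator_of_mem hα, hg, Set.indicator_of_mem hα]
      gcongr
      rw [ancSum_eq, Finset.sum_filter]
      refine le_trans (Finset.sum_le_sum fun β _ => ?_) (ENNReal.sum_le_tsum F)
      split_ifs with hd
      · by_cases hβ : β ∈ T.geodesic x
        · rw [Set.indicator_of_mem hβ,
            Set.indicator_of_mem (show β ∈ {β | T.Below α β} from below_of_depth_le hα hβ hd)]
        · simp [hβ]
      · exact zero_le
    · simp [hg, hα]
  have ht : Filter.Tendsto (fun F : Finset T.Edge => (∑ α ∈ F, g α) ^ (n + 1)) Filter.atTop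
      (nhds (T.treeSum f x ^ (n + 1))) :=
    ((ENNReal.continuous_pow (n + 1)).tendsto _).comp ENNReal.summable.hasSum
  exact le_of_tendsto' ht hfin

theorem indicator_geodesic_eq (f : T.Edge → ℝ≥0∞) (α : T.Edge) :
    (fun x => (T.geodesic x).indicator f α) = (T.succSet α).indicator fun _ => f α := by
  ext x
  by_cases hx : α ∈ T.geodesic x
  · rw [Set.indicator_of_mem hx, Set.indicator_of_mem (show x ∈ T.succSet α from hx)]
  · rw [Set.indicator_of_notMem hx, Set.indicator_of_notMem (show x ∉ T.succSet α from hx)]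

theorem lintegral_treeSum [Countable V] (μ : Measure T.Closure) (f : T.Edge → ℝ≥0∞) :
    ∫⁻ x, T.treeSum f x ∂μ = ∑' α, f α * μ (T.succSet α) := by
  simp only [treeSum]
  rw [lintegral_tsum]
  · congr with α
    rw [indicator_geodesic_eq, lintegral_indicator_const (T.measurableSet_succSet α)]
  · intro α
    rw [indicator_geodesic_eq]
    exact (measurable_const.indicator (T.measurableSet_succSet α)).aemeasurable

theorem measurable_treeSum [Countable V] (f : T.Edge → ℝ≥0∞) : Measurable (T.treeSum f) := by
  refine Measurable.tsum fun α => ?_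
  rw [indicator_geodesic_eq]
  exact measurable_const.indicator (T.measurableSet_succSet α)

theorem lintegral_treeSum_pow_succ_le [Countable V] (μ : Measure T.Closure)
    (f : T.Edge → ℝ≥0∞) (n : ℕ) :
    ∫⁻ x, T.treeSum f x ^ (n + 1) ∂μ ≤
      (n + 1) * ∑' α, f α * T.ancSum f α ^ n * μ (T.succSet α) := by
  rw [← lintegral_treeSum, ← lintegral_const_mul _ (measurable_treeSum _)]
  exact lintegral_mono fun x => treeSum_pow_succ_le f x n

theorem Below.measure_le {α β : T.Edge} (h : T.Below β α) (μ : Measure T.Closure) :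
    μ (T.succSet β) ≤ μ (T.succSet α) :=
  measure_mono fun _ hx => h.mem_geodesic hx

theorem tsum_below_sq_le {μ : Measure T.Closure} (hμ : ∀ α : T.Edge, μ (T.succSet α) < ∞)
    (α : T.Edge) :
    ∑' β, {β | T.Below β α}.indicator (fun β => μ (T.succSet β) ^ 2) β ≤
      T.massEnergy μ * μ (T.succSet α) := by
  rw [← tsum_subtype {β | T.Below β α} fun β => μ (T.succSet β) ^ 2]
  by_cases h0 : μ (T.succSet α) = 0
  · rw [h0, mul_zero]
    refine le_of_eq (ENNReal.tsum_eq_zero.2 fun β => ?_)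
    have := Below.measure_le β.2 μ
    rw [h0] at this
    simp [nonpos_iff_eq_zero.1 this]
  · rw [mul_comm, ← ENNReal.inv_mul_le_iff h0 (hμ α).ne]
    exact le_iSup (fun α : T.Edge => (μ (T.succSet α))⁻¹ *
      ∑' β : {β : T.Edge // T.Below β α}, μ (T.succSet β) ^ 2) α

/-- Apply the chain rule at each `e(α)`, exchange the sums, and bound the sum of `μ(S(α))²` over `α
⊆ β` by `massEnergy`. The right side has one power of `ancSum` fewer, which allows iteration. -/
theorem tsum_sq_mul_ancSum_pow_succ_le {μ : Measure T.Closure}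
    (hμ : ∀ α : T.Edge, μ (T.succSet α) < ∞) (f : T.Edge → ℝ≥0∞) (n : ℕ) :
    ∑' α, μ (T.succSet α) ^ 2 * T.ancSum f α ^ (n + 1) ≤
      (n + 1) * T.massEnergy μ * ∑' α, f α * T.ancSum f α ^ n * μ (T.succSet α) := by
  set g : T.Edge → ℝ≥0∞ := fun α => f α * T.ancSum f α ^ n with hg
  calc ∑' α, μ (T.succSet α) ^ 2 * T.ancSum f α ^ (n + 1)
      ≤ ∑' α, μ (T.succSet α) ^ 2 * ((n + 1) * T.ancSum g α) := by
        gcongr with α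
        exact treeSum_pow_succ_le f _ n
    _ = (n + 1) * ∑' α, ∑' β,
          g β * {α | T.Below α β}.indicator (fun α => μ (T.succSet α) ^ 2) α := by
        rw [← ENNReal.tsum_mul_left]
        congr with α
        rw [mul_left_comm, ancSum_eq, ← ENNReal.tsum_mul_left]
        congr 2 with β
        by_cases hαβ : T.Below α β <;> simp [hαβ, mul_comm]
    _ = (n + 1) * ∑' β, g β *
          ∑' α, {α | T.Below α β}.indicator (fun α => μ (T.succSet α) ^ 2) α := by
        rw [ENNReal.tsum_comm]
        simp_rw [ENNReal.tsum_mul_left]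
    _ ≤ (n + 1) * ∑' β, g β * (T.massEnergy μ * μ (T.succSet β)) := by
        gcongr with β
        exact tsum_below_sq_le hμ β
    _ = _ := by
        rw [mul_assoc, ← ENNReal.tsum_mul_left (a := T.massEnergy μ)]
        congr 3 with β
        ring

theorem ancSum_ne_top {f : T.Edge → ℝ≥0∞} (hf : ∀ α, f α ≠ ∞) (α : T.Edge) :
    T.ancSum f α ≠ ∞ := by
  have := (T.vertexGeodesic_finite (T.endVertex α)).fintype
  rw [ancSum, treeSum, ← tsum_subtype]
  change ∑' β : T.vertexGeodesic (T.endVertex α), f β ≠ ∞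
  rw [tsum_fintype]
  exact ENNReal.sum_ne_top.2 fun _ _ => hf _

/-- Finite support makes `Y` finite, so that a factor `Y` can be cancelled from `Y² ≤ ‖f‖² · 2 [[μ]]
Y`. The constant is `4 = 2 · 2`, one factor from each use of the chain rule. -/
theorem lintegral_treeSum_sq_le_of_finite_support [Countable V] {μ : Measure T.Closure}
    (hμ : ∀ α : T.Edge, μ (T.succSet α) < ∞) {f : T.Edge → ℝ≥0∞} (hf : ∀ α, f α ≠ ∞)
    (hfin : (Function.support f).Finite) :
    ∫⁻ x, T.treeSum f x ^ 2 ∂μ ≤ 4 * T.massEnergy μ * ∑' α, f α ^ 2 := by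
  set Y := ∑' α, f α * T.ancSum f α ^ 1 * μ (T.succSet α) with hY
  have hYtop : Y ≠ ∞ := by
    rw [hY, tsum_eq_sum (s := hfin.toFinset)]
    · refine ENNReal.sum_ne_top.2 fun α _ => ?_
      exact ENNReal.mul_ne_top (ENNReal.mul_ne_top (hf α)
        (ENNReal.pow_ne_top (ancSum_ne_top hf α))) (hμ α).ne
    · intro α hα
      simp only [Set.Finite.mem_toFinset, Function.mem_support, not_not] at hα
      simp [hα]
  have h1 : ∫⁻ x, T.treeSum f x ^ 2 ∂μ ≤ 2 * Y := by
    have := lintegral_treeSum_pow_succ_le μ f 1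
    norm_num at this ⊢
    simpa [hY, one_add_one_eq_two] using this
  have h2 : Y ^ 2 ≤ (∑' α, f α ^ 2) * (2 * T.massEnergy μ * Y) := by
    have h := ENNReal.sq_tsum_mul_le f (fun α => μ (T.succSet α) * T.ancSum f α)
    have h' := tsum_sq_mul_ancSum_pow_succ_le hμ f 1
    rw [← hY, Nat.cast_one, one_add_one_eq_two, one_add_one_eq_two] at h'
    simp_rw [mul_pow] at h
    have : Y = ∑' α, f α * (μ (T.succSet α) * T.ancSum f α) := by
      rw [hY]; congr with α; ring
    rw [this]
    refine h.trans ?_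
    rw [← this]
    gcongr
  have h3 : Y ≤ 2 * T.massEnergy μ * ∑' α, f α ^ 2 := by
    by_cases h0 : Y = 0
    · rw [h0]; exact zero_le
    · rw [← ENNReal.mul_le_mul_iff_left h0 hYtop, ← sq]
      refine h2.trans (le_of_eq (by ring))
  calc _ ≤ _ := h1
    _ ≤ 2 * (2 * T.massEnergy μ * ∑' α, f α ^ 2) := by gcongr
    _ = _ := by ring

/-- Monotone convergence along the finite sets of edges. -/
theorem lintegral_treeSum_sq_le [Countable V] {μ : Measure T.Closure}
    (hμ : ∀ α : T.Edge, μ (T.succSet α) < ∞) {f : T.Edge → ℝ≥0∞} (hf : ∀ α, f α ≠ ∞) :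
    ∫⁻ x, T.treeSum f x ^ 2 ∂μ ≤ 4 * T.massEnergy μ * ∑' α, f α ^ 2 := by
  classical
  let g : Finset T.Edge → T.Edge → ℝ≥0∞ := fun F => (F : Set T.Edge).indicator f
  have hgsum : ∀ F x, T.treeSum (g F) x = ∑ α ∈ F, (T.geodesic x).indicator f α := by
    intro F x
    rw [treeSum, tsum_eq_sum (s := F)]
    · refine Finset.sum_congr rfl fun α hα => ?_
      simp [g, Set.indicator, hα]
    · intro α hα
      simp [g, Set.indicator, hα]
  have hmono : Monotone fun F => fun x => T.treeSum (g F) x ^ 2 := by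
    intro F F' h x
    simp only [hgsum]
    gcongr
  have hsup : ∀ x, T.treeSum f x ^ 2 = ⨆ F, T.treeSum (g F) x ^ 2 := by
    intro x
    have h : Filter.Tendsto (fun F => T.treeSum (g F) x) Filter.atTop
        (nhds (T.treeSum f x)) := by
      simp only [hgsum]
      exact ENNReal.summable.hasSum
    exact tendsto_nhds_unique (((ENNReal.continuous_pow 2).tendsto _).comp h)
      (tendsto_atTop_iSup fun F F' hF => hmono hF x)
  simp_rw [hsup]
  rw [lintegral_iSup_directed (fun F => ((measurable_treeSum _).pow_const 2).aemeasurable)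
    hmono.directed_le]
  refine iSup_le fun F => ?_
  refine (lintegral_treeSum_sq_le_of_finite_support hμ (f := g F) (fun α => ?_) ?_).trans ?_
  · exact ne_top_of_le_ne_top (hf α) (Set.indicator_le_self _ _ _)
  · exact F.finite_toSet.subset (Set.support_indicator_subset)
  · gcongr with α
    exact Set.indicator_le_self _ _ _

/-! ### Equivalence of Hardy's inequality and finite mass-energy -/

theorem massEnergy_lt_top_of_hardyInequality [Countable V] {μ : Measure T.Closure}
    (hμ : ∀ α : T.Edge, μ (T.succSet α) < ∞) (h : T.HardyInequality μ) :
    T.massEnergy μ < ∞ := by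
  classical
  obtain ⟨C, hC⟩ := h
  refine lt_of_le_of_lt (iSup_le fun α => ?_) (ENNReal.coe_lt_top (r := C))
  by_cases h0 : μ (T.succSet α) = 0
  · have hz : ∀ β : {β : T.Edge // T.Below β α}, μ (T.succSet β) = 0 := fun β =>
      nonpos_iff_eq_zero.1 (h0 ▸ Below.measure_le β.2 μ)
    simp [hz]
  rw [ENNReal.inv_mul_le_iff h0 (hμ α).ne, ENNReal.tsum_eq_iSup_sum]
  refine iSup_le fun F => ?_
  set X := ∑ β ∈ F, μ (T.succSet β) ^ 2 with hX
  have hXtop : X ≠ ∞ := ENNReal.sum_ne_top.2 fun β _ => ENNReal.pow_ne_top (hμ β).ne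
  let F' : Finset T.Edge := F.map (Function.Embedding.subtype _)
  have hF' : ∀ β ∈ F', T.Below β α := by
    intro β hβ
    obtain ⟨γ, -, rfl⟩ := Finset.mem_map.1 hβ
    exact γ.2
  -- The extremal function of the dual problem: both `∑ φ²` and `∫ 𝓘φ dμ` equal `X`, and `𝓘φ`
  -- vanishes off `S(α)`. Truncation to a finite set keeps `X` finite.
  let φ : T.Edge → ℝ≥0 := fun β => if β ∈ F' then (μ (T.succSet β)).toNNReal else 0
  have hφ : ∀ β, (φ β : ℝ≥0∞) = if β ∈ F' then μ (T.succSet β) else 0 := by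
    intro β
    simp only [φ]
    split_ifs
    · exact ENNReal.coe_toNNReal (hμ β).ne
    · simp
  have hXs : ∀ g : T.Edge → ℝ≥0∞, (∑ β ∈ F, g β) = ∑' β, if β ∈ F' then g β else 0 := by
    intro g
    rw [tsum_eq_sum (s := F') (fun β hβ => by simp [hβ]), Finset.sum_congr rfl
      (fun β hβ => if_pos hβ)]
    exact (Finset.sum_map F (Function.Embedding.subtype _) g).symm
  have h1 : ∑' β, (φ β : ℝ≥0∞) ^ 2 = X := by
    rw [hX, hXs fun β => μ (T.succSet β) ^ 2]
    congr with β
    rw [hφ]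
    split_ifs <;> simp
  have h2 : ∫⁻ x, T.hardyOp φ x ∂μ = X := by
    simp_rw [hardyOp_eq_treeSum]
    rw [lintegral_treeSum, hX, hXs fun β => μ (T.succSet β) ^ 2]
    congr with β
    rw [hφ]
    split_ifs <;> simp [sq]
  have h3 : ∀ x, (T.succSet α).indicator 1 x * T.hardyOp φ x = T.hardyOp φ x := by
    intro x
    by_cases hx : x ∈ T.succSet α
    · simp [hx]
    · have : T.hardyOp φ x = 0 := by
        refine ENNReal.tsum_eq_zero.2 fun β => ?_
        rw [hφ, if_neg]
        exact fun hβ => hx ((hF' _ hβ).mem_geodesic β.2)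
      rw [this, mul_zero]
  have hm : Measurable (T.hardyOp φ) := by
    have : T.hardyOp φ = T.treeSum fun α => φ α := funext (T.hardyOp_eq_treeSum φ)
    rw [this]
    exact measurable_treeSum _
  have h4 := ENNReal.sq_lintegral_mul_le μ (f := (T.succSet α).indicator 1) (g := T.hardyOp φ)
    (measurable_one.indicator (T.measurableSet_succSet α)).aemeasurable hm.aemeasurable
  have h5 : ∀ x, (T.succSet α).indicator (1 : T.Closure → ℝ≥0∞) x ^ 2 =
      (T.succSet α).indicator 1 x := by
    intro x
    by_cases hx : x ∈ T.succSet α <;> simp [hx]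
  simp_rw [h3, h5, h2] at h4
  rw [lintegral_indicator_one (T.measurableSet_succSet α)] at h4
  have h6 := hC φ
  rw [h1] at h6
  by_cases hX0 : X = 0
  · rw [hX0]; exact zero_le
  -- Cauchy–Schwarz on `S(α)` and the Hardy inequality give `X² ≤ μ(S(α)) · C X`.
  · rw [← ENNReal.mul_le_mul_iff_left hX0 hXtop, ← sq, mul_assoc]
    exact h4.trans (by gcongr)

theorem hardyInequality_of_massEnergy_lt_top [Countable V] {μ : Measure T.Closure}
    (hμ : ∀ α : T.Edge, μ (T.succSet α) < ∞) (h : T.massEnergy μ < ∞) :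
    T.HardyInequality μ := by
  refine ⟨(4 * T.massEnergy μ).toNNReal, fun φ => ?_⟩
  rw [ENNReal.coe_toNNReal (ENNReal.mul_ne_top (by simp) h.ne)]
  simp_rw [hardyOp_eq_treeSum]
  exact lintegral_treeSum_sq_le hμ fun α => ENNReal.coe_ne_top

end HardyTree

/-! ### Comparison of the testing constants with the mass-energy -/

theorem ENNReal.le_one_add_rpow (x : ℝ≥0∞) {s : ℝ} (hs : 1 ≤ s) : x ≤ 1 + x ^ s := by
  rcases le_total x 1 with h | h
  · exact h.trans le_self_add
  · calc x = x ^ (1 : ℝ) := (ENNReal.rpow_one x).symm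
      _ ≤ x ^ s := ENNReal.rpow_le_rpow_of_exponent_le h hs
      _ ≤ _ := le_add_self

/-- Reduces real exponents to integer ones; rescaling by `A` keeps the bound homogeneous of degree
`s`. -/
theorem ENNReal.rpow_le_add_pow {A : ℝ≥0∞} (hA0 : A ≠ 0) (hA : A ≠ ∞) (x : ℝ≥0∞) {s : ℝ}
    (hs : 0 ≤ s) {n : ℕ} (hn : s ≤ n) : x ^ s ≤ A ^ s * (1 + (A⁻¹ * x) ^ n) := by
  have hx : x = A * (A⁻¹ * x) := by
    rw [← mul_assoc, ENNReal.mul_inv_cancel hA0 hA, one_mul]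
  nth_rw 1 [hx]
  rw [ENNReal.mul_rpow_of_nonneg _ _ hs]
  gcongr
  rcases le_total (A⁻¹ * x) 1 with h | h
  · exact (ENNReal.rpow_le_one h hs).trans le_self_add
  · refine le_trans ?_ le_add_self
    rw [← ENNReal.rpow_natCast]
    exact ENNReal.rpow_le_rpow_of_exponent_le h hn

theorem ENNReal.add_pow_le_two_pow (a b : ℝ≥0∞) (n : ℕ) :
    (a + b) ^ n ≤ 2 ^ n * (a ^ n + b ^ n) := by
  wlog h : a ≤ b generalizing a b
  · rw [add_comm a b, add_comm (a ^ n)]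
    exact this b a (le_of_not_ge h)
  calc (a + b) ^ n ≤ (b + b) ^ n := by gcongr
    _ = 2 ^ n * b ^ n := by rw [← two_mul, mul_pow]
    _ ≤ _ := by gcongr; exact le_add_self

namespace HardyTree

variable {V : Type u} {T : HardyTree V}

/-- Tonelli: `d(x ∧ y)` counts the edges common to both geodesics. -/
theorem lintegral_confluentDist [Countable V] (μ : Measure T.Closure) (α : T.Edge)
    (y : T.Closure) :
    ∫⁻ x in T.succSet α, T.confluentDist x y ∂μ =
      T.treeSum (fun β => μ (T.succSet β ∩ T.succSet α)) y := by
  have h : ∀ x, T.confluentDist x y = T.treeSum ((T.geodesic y).indicator 1) x := by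
    intro x
    rw [confluentDist, treeSum, ← ENNReal.tsum_set_one,
      tsum_subtype (T.geodesic x ∩ T.geodesic y) fun _ => (1 : ℝ≥0∞), ← Set.indicator_indicator]
    rfl
  simp_rw [h]
  rw [lintegral_treeSum, treeSum]
  congr with β
  rw [Measure.restrict_apply (T.measurableSet_succSet β)]
  by_cases hβ : β ∈ T.geodesic y <;> simp [hβ]

theorem tsum_mul_ancSum_pow_le {μ : Measure T.Closure}
    (hμ : ∀ α : T.Edge, μ (T.succSet α) < ∞) (α : T.Edge) {f : T.Edge → ℝ≥0∞}
    (hf : f = {β | T.Below β α}.indicator fun β => μ (T.succSet β)) (n : ℕ) :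
    ∑' β, f β * T.ancSum f β ^ n * μ (T.succSet β) ≤
      n.factorial * T.massEnergy μ ^ (n + 1) * μ (T.succSet α) := by
  induction n with
  | zero =>
    have h := tsum_below_sq_le hμ α
    simp only [pow_zero, mul_one, Nat.factorial_zero, Nat.cast_one, one_mul, zero_add, pow_one]
    refine le_trans (le_of_eq ?_) h
    congr with β
    rw [hf]
    by_cases hβ : T.Below β α <;> simp [hβ, sq]
  | succ n ih =>
    calc ∑' β, f β * T.ancSum f β ^ (n + 1) * μ (T.succSet β)
        ≤ ∑' β, μ (T.succSet β) ^ 2 * T.ancSum f β ^ (n + 1) := by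
          refine ENNReal.tsum_le_tsum fun β => ?_
          rw [mul_right_comm, sq]
          gcongr
          rw [hf]
          exact Set.indicator_le_self _ _ _
      _ ≤ _ := tsum_sq_mul_ancSum_pow_succ_le hμ f n
      _ ≤ (n + 1) * T.massEnergy μ * (n.factorial * T.massEnergy μ ^ (n + 1) *
            μ (T.succSet α)) := by gcongr
      _ = _ := by
          rw [Nat.factorial_succ]
          push_cast
          ring

theorem lintegral_treeSum_pow_le [Countable V] {μ : Measure T.Closure}
    (hμ : ∀ α : T.Edge, μ (T.succSet α) < ∞) (α : T.Edge) {f : T.Edge → ℝ≥0∞}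
    (hf : f = {β | T.Below β α}.indicator fun β => μ (T.succSet β)) (n : ℕ) :
    ∫⁻ x, T.treeSum f x ^ (n + 1) ∂μ ≤
      (n + 1).factorial * T.massEnergy μ ^ (n + 1) * μ (T.succSet α) := by
  refine (lintegral_treeSum_pow_succ_le μ f n).trans ?_
  refine (mul_le_mul_right (tsum_mul_ancSum_pow_le hμ α hf n) _).trans (le_of_eq ?_)
  rw [Nat.factorial_succ]
  push_cast
  ring

/-- Hardy's inequality tested on the indicator of `[o*, e(α)]`, whose sum along any geodesic through
`α` is the number of these edges. -/
theorem ancSum_one_mul_measure_le [Countable V] {μ : Measure T.Closure}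
    (hμ : ∀ α : T.Edge, μ (T.succSet α) < ∞) (α : T.Edge) :
    T.ancSum 1 α * μ (T.succSet α) ≤ 4 * T.massEnergy μ := by
  set N := T.ancSum 1 α with hN
  have hNtop : N ≠ ∞ := ancSum_ne_top (fun _ => ENNReal.one_ne_top) α
  by_cases hN0 : N = 0
  · rw [hN0, zero_mul]; exact zero_le
  set f : T.Edge → ℝ≥0∞ := {β | T.Below α β}.indicator 1 with hf
  have h := lintegral_treeSum_sq_le hμ (f := f) fun β => by
    by_cases hβ : T.Below α β <;> simp [hf, hβ]
  have h1 : ∑' β, f β ^ 2 = N := by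
    rw [hN, ancSum_eq]
    congr with β
    by_cases hβ : T.Below α β <;> simp [hf, hβ]
  have h2 : ∀ x ∈ T.succSet α, N ≤ T.treeSum f x := by
    intro x hx
    rw [hN, ancSum_eq, treeSum]
    gcongr with β
    by_cases hβ : T.Below α β
    · rw [Set.indicator_of_mem (hβ.mem_geodesic hx)]
    · simp [hβ]
  have h3 : N ^ 2 * μ (T.succSet α) ≤ ∫⁻ x, T.treeSum f x ^ 2 ∂μ := by
    calc N ^ 2 * μ (T.succSet α) = ∫⁻ _ in T.succSet α, N ^ 2 ∂μ := by
          rw [setLIntegral_const]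
      _ ≤ ∫⁻ x in T.succSet α, T.treeSum f x ^ 2 ∂μ := by
          refine setLIntegral_mono' (T.measurableSet_succSet α) fun x hx => ?_
          gcongr
          exact h2 x hx
      _ ≤ _ := setLIntegral_le_lintegral _ _
  rw [h1] at h
  rw [← ENNReal.mul_le_mul_iff_left hN0 hNtop]
  refine le_trans (le_of_eq ?_) (h3.trans h)
  ring

/-- Every edge of `[o*, y]` is below or above `α`. Those below give `treeSum f y`; each one above
contributes `μ(S(α))`, and `ancSum_one_mul_measure_le` bounds their total. -/
theorem lintegral_confluentDist_le [Countable V] {μ : Measure T.Closure}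
    (hμ : ∀ α : T.Edge, μ (T.succSet α) < ∞) (α : T.Edge) {f : T.Edge → ℝ≥0∞}
    (hf : f = {β | T.Below β α}.indicator fun β => μ (T.succSet β)) {y : T.Closure}
    (hy : y ∈ T.succSet α) :
    ∫⁻ x in T.succSet α, T.confluentDist x y ∂μ ≤ 4 * T.massEnergy μ + T.treeSum f y := by
  rw [lintegral_confluentDist, add_comm]
  refine le_trans ?_ (add_le_add_right (ancSum_one_mul_measure_le hμ α) _)
  rw [ancSum_eq, ← ENNReal.tsum_mul_right, treeSum, treeSum, ← ENNReal.tsum_add]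
  gcongr with β
  by_cases hβ : β ∈ T.geodesic y
  · simp only [hβ, Set.indicator_of_mem]
    rcases le_total (T.depth α) (T.depth β) with h | h
    · have hb : T.Below β α := below_of_depth_le hβ hy h
      refine le_trans ?_ le_self_add
      rw [hf, Set.indicator_of_mem (show β ∈ {β | T.Below β α} from hb)]
      exact measure_mono Set.inter_subset_left
    · have hb : T.Below α β := below_of_depth_le hy hβ h
      refine le_trans ?_ le_add_self
      rw [Set.indicator_of_mem (show β ∈ {β | T.Below α β} from hb), Pi.one_apply, one_mul]
      exact measure_mono Set.inter_subset_right
  · simp [hβ]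

theorem testing_le [Countable V] {μ : Measure T.Closure}
    (hμ : ∀ α : T.Edge, μ (T.succSet α) < ∞) {s : ℝ} (hs : 0 < s) {n : ℕ} (hn : s ≤ n + 1) :
    T.testing μ s ≤ ((1 + 2 ^ (n + 1) * (4 ^ (n + 1) + (n + 1).factorial) : ℝ≥0) : ℝ≥0∞) *
      T.massEnergy μ ^ s := by
  push_cast
  set A := T.massEnergy μ with hA
  by_cases hAtop : A = ∞
  · rw [hAtop, ENNReal.top_rpow_of_pos hs, ENNReal.mul_top]
    · exact le_top
    · simp
  refine iSup_le fun α => ?_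
  rw [setLAverage_eq]
  by_cases h0 : μ (T.succSet α) = 0
  · rw [setLIntegral_measure_zero _ _ h0, ENNReal.zero_div]
    exact zero_le
  refine ENNReal.div_le_of_le_mul ?_
  -- Since `α ⊆ α`, the energy at `α` contains the positive term `μ(S(α))²`. Dividing by `A` is
  -- therefore legitimate.
  have hA0 : A ≠ 0 := by
    intro hA0
    have h := tsum_below_sq_le hμ α
    rw [← hA, hA0, zero_mul, nonpos_iff_eq_zero, ENNReal.tsum_eq_zero] at h
    have := h α
    rw [Set.indicator_of_mem (show α ∈ {β | T.Below β α} from T.below_refl α)] at this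
    exact h0 (pow_eq_zero_iff two_ne_zero |>.1 this)
  set f : T.Edge → ℝ≥0∞ := {β | T.Below β α}.indicator fun β => μ (T.succSet β) with hf
  have hpt : ∀ y ∈ T.succSet α, (∫⁻ x in T.succSet α, T.confluentDist x y ∂μ) ^ s ≤
      A ^ s * (1 + (A⁻¹) ^ (n + 1) *
        (2 ^ (n + 1) * ((4 * A) ^ (n + 1) + T.treeSum f y ^ (n + 1)))) := by
    intro y hy
    refine (ENNReal.rpow_le_add_pow hA0 hAtop _ hs.le (n := n + 1) (by exact_mod_cast hn)).trans ?_
    rw [mul_pow]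
    gcongr
    refine le_trans ?_ (ENNReal.add_pow_le_two_pow _ _ _)
    gcongr
    exact lintegral_confluentDist_le hμ α hf hy
  have hmeas : Measurable fun y => T.treeSum f y ^ (n + 1) :=
    (measurable_treeSum f).pow_const _
  refine (setLIntegral_mono' (T.measurableSet_succSet α) hpt).trans ?_
  rw [lintegral_const_mul _ (by fun_prop), lintegral_add_left measurable_const,
    lintegral_const_mul _ (by fun_prop), lintegral_const_mul _ (by fun_prop),
    lintegral_add_left measurable_const, setLIntegral_const, setLIntegral_const, one_mul]
  have hU : ∫⁻ y in T.succSet α, T.treeSum f y ^ (n + 1) ∂μ ≤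
      (n + 1).factorial * A ^ (n + 1) * μ (T.succSet α) :=
    (setLIntegral_le_lintegral _ _).trans (lintegral_treeSum_pow_le hμ α hf n)
  calc _ ≤ A ^ s * (μ (T.succSet α) + A⁻¹ ^ (n + 1) * (2 ^ (n + 1) *
        ((4 * A) ^ (n + 1) * μ (T.succSet α) +
          (n + 1).factorial * A ^ (n + 1) * μ (T.succSet α)))) := by gcongr
    _ = A ^ s * (μ (T.succSet α) + (A⁻¹ * A) ^ (n + 1) * (2 ^ (n + 1) *
        (4 ^ (n + 1) * μ (T.succSet α) + (n + 1).factorial * μ (T.succSet α)))) := by ring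
    _ = _ := by
      rw [ENNReal.inv_mul_cancel hA0 hAtop]
      ring

/-- Discard the edges not below `α` from the double integral of `d(x ∧ y)` over `S(α)`, then use `t
≤ 1 + t^s`. The bound is not homogeneous, but only finiteness is needed. -/
theorem massEnergy_le_one_add_testing [Countable V] {μ : Measure T.Closure}
    (hμ : ∀ α : T.Edge, μ (T.succSet α) < ∞) {s : ℝ} (hs : 1 ≤ s) :
    T.massEnergy μ ≤ 1 + T.testing μ s := by
  refine iSup_le fun α => ?_
  by_cases h0 : μ (T.succSet α) = 0
  · have hz : ∀ β : {β : T.Edge // T.Below β α}, μ (T.succSet β) = 0 := fun β =>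
      nonpos_iff_eq_zero.1 (h0 ▸ Below.measure_le β.2 μ)
    simp [hz]
  rw [ENNReal.inv_mul_le_iff h0 (hμ α).ne]
  have htest : ∫⁻ y in T.succSet α, (∫⁻ x in T.succSet α, T.confluentDist x y ∂μ) ^ s ∂μ ≤
      T.testing μ s * μ (T.succSet α) := by
    rw [← ENNReal.div_le_iff h0 (hμ α).ne, ← setLAverage_eq]
    exact le_iSup (fun α : T.Edge => ⨍⁻ y in T.succSet α,
      (∫⁻ x in T.succSet α, T.confluentDist x y ∂μ) ^ s ∂μ) α
  calc ∑' β : {β : T.Edge // T.Below β α}, μ (T.succSet β) ^ 2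
      = ∑' β, {β | T.Below β α}.indicator (fun β => μ (T.succSet β) ^ 2) β :=
        tsum_subtype {β | T.Below β α} fun β => μ (T.succSet β) ^ 2
    _ ≤ ∑' β, μ (T.succSet β ∩ T.succSet α) * μ.restrict (T.succSet α) (T.succSet β) := by
        gcongr with β
        rw [Measure.restrict_apply (T.measurableSet_succSet β)]
        by_cases hβ : T.Below β α
        · rw [Set.indicator_of_mem (show β ∈ {β | T.Below β α} from hβ),
            Set.inter_eq_self_of_subset_left (show T.succSet β ⊆ T.succSet α from
              fun x hx => hβ.mem_geodesic hx), sq]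
        · simp [hβ]
    _ = ∫⁻ y in T.succSet α, ∫⁻ x in T.succSet α, T.confluentDist x y ∂μ ∂μ := by
        simp_rw [lintegral_confluentDist]
        rw [lintegral_treeSum]
    _ ≤ ∫⁻ y in T.succSet α,
          (1 + (∫⁻ x in T.succSet α, T.confluentDist x y ∂μ) ^ s) ∂μ :=
        lintegral_mono fun y => ENNReal.le_one_add_rpow _ hs
    _ ≤ μ (T.succSet α) * (1 + T.testing μ s) := by
        rw [lintegral_add_left measurable_const, setLIntegral_const, one_mul, mul_add, mul_one,
          mul_comm _ (T.testing μ s)]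
        gcongr

theorem massEnergy_lt_top_of_testing_lt_top [Countable V] {μ : Measure T.Closure}
    (hμ : ∀ α : T.Edge, μ (T.succSet α) < ∞) {s : ℝ} (hs : 1 ≤ s) (h : T.testing μ s < ∞) :
    T.massEnergy μ < ∞ :=
  (massEnergy_le_one_add_testing hμ hs).trans_lt (ENNReal.add_lt_top.2 ⟨ENNReal.one_lt_top, h⟩)

theorem testing_lt_top_of_massEnergy_lt_top [Countable V] {μ : Measure T.Closure}
    (hμ : ∀ α : T.Edge, μ (T.succSet α) < ∞) {s : ℝ} (hs : 0 < s) (h : T.massEnergy μ < ∞) :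
    T.testing μ s < ∞ := by
  have hn : s ≤ (⌈s⌉₊ : ℝ) + 1 := (Nat.le_ceil s).trans (by linarith)
  exact (testing_le hμ hs hn).trans_lt (ENNReal.mul_lt_top ENNReal.coe_lt_top
    (ENNReal.rpow_lt_top_of_nonneg hs.le h.ne))

end HardyTree

theorem mainTheorem3 :
    (∀ s : ℝ, 1 < s → ∃ C : ℝ≥0, ∀ (V : Type u) [Countable V] (T : HardyTree V)
      (μ : Measure T.Closure), (∀ α : T.Edge, μ (T.succSet α) < ∞) →
        T.testing μ s ≤ C * T.massEnergy μ ^ s) ∧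
    (∀ (V : Type u) [Countable V] (T : HardyTree V)
      (μ : Measure T.Closure), (∀ α : T.Edge, μ (T.succSet α) < ∞) →
        (T.HardyInequality μ ↔ ∃ s : ℝ, 1 ≤ s ∧ T.testing μ s < ∞) ∧
        (T.HardyInequality μ ↔ ∀ s : ℝ, 1 ≤ s → T.testing μ s < ∞)) := by
  -- With `n = ⌈s⌉₊` the constant of `testing_le` depends on `s` alone.
  refine ⟨fun s hs => ⟨_, fun V _ T μ hμ => HardyTree.testing_le hμ (n := ⌈s⌉₊)
    (zero_lt_one.trans hs) ((Nat.le_ceil s).trans (by linarith))⟩, fun V _ T μ hμ => ?_⟩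
  have hall : T.HardyInequality μ → ∀ s : ℝ, 1 ≤ s → T.testing μ s < ∞ := fun h s hs =>
    HardyTree.testing_lt_top_of_massEnergy_lt_top hμ (zero_lt_one.trans_le hs)
      (HardyTree.massEnergy_lt_top_of_hardyInequality hμ h)
  have hex : (∃ s : ℝ, 1 ≤ s ∧ T.testing μ s < ∞) → T.HardyInequality μ := fun ⟨_, hs, h⟩ =>
    HardyTree.hardyInequality_of_massEnergy_lt_top hμ
      (HardyTree.massEnergy_lt_top_of_testing_lt_top hμ hs h)
  exact ⟨⟨fun h => ⟨1, le_rfl, hall h 1 le_rfl⟩, hex⟩,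
    ⟨hall, fun h => hex ⟨1, le_rfl, h 1 le_rfl⟩⟩⟩
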